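/- **Theorem 7.1.** Let $A$ be a C*-algebra (not necessarily unital), let $E$ be a right Hilbert $A$-module (complete, with $A$-valued inner product $\langle\cdot,\cdot\rangle$ conjugate linear in the first and $A$-linear in the second variable), and let $E_1$ and $E_2$ be closed $A$-submodules of $E$. Assume that $E_1$ and $E_2$ are countably generated as Hilbert $A$-modules, i.e., for $i=1,2$ there is a countable set $S_i\subseteq E_i$ such that the finite sums of elements $xa$ ($x\in S_i$, $a\in A$) are dense in $E_i$. Let $E''$ and $A''$ denote the biduals of $E$ and $A$, and regard $E''$ as a Hilbert C*-module over $A''$, its $A''$-valued inner product being the extension of that of $E$ by weak-* continuity; thus, for $\eta\in E\subseteq E''$, the map $\langle\eta,\cdot\rangle: E''\to A''$ is the second transpose of $\langle\eta,\cdot\rangle: E\to A$. Let $E_1''\subseteq E''$ be the bidual of $E_1$, embedded by the second transpose of the inclusion $E_1\subseteq E$. Suppose that no non-zero element of $E_1''$ is orthogonal to $E_2$, i.e., if $\xi\in E_1''$ and $\langle\eta,\xi\rangle=0$ in $A''$ for all $\eta\in E_2$, then $\xi=0$. Then $E_1$ is isomorphic, as a Hilbert $A$-module, to a closed submodule of $E_2$: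 there are a closed $A$-submodule $G\subseteq E_2$ and a bijective $A$-linear map $u:E_1\to G$ with $\langle ux,uy\rangle=\langle x,y\rangle$ for all $x,y\in E_1$. -/

import Mathlib

open scoped RightActions

noncomputable section

namespace HilbertModule

/-! ### Right Hilbert modules

Mathlib's `CStarModule B E` is written with the elements of `B` acting on the left of `E`,
with `⟪x, b • y⟫ = b * ⟪x, y⟫`. A right Hilbert `A`-module is therefore
a `CStarModule Aᵐᵒᵖ E`, complete in its norm; the right action of `a : A` on `x : E`
is `x <• a`, that is `MulOpposite.op a • x`. -/

section Inner

variable (A : Type*) {E : Type*} [NonUnitalCStarAlgebra A] [PartialOrder A]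
  [NormedAddCommGroup E] [NormedSpace ℂ E] [SMul Aᵐᵒᵖ E] [CStarModule Aᵐᵒᵖ E]

/-- The `A`-valued inner product `⟨x, y⟩` of a right Hilbert `A`-module, conjugate linear in `x`
and linear in `y`. -/
def ainner (x y : E) : A := MulOpposite.unop (inner Aᵐᵒᵖ x y)

theorem ainner_smul_right (x y : E) (a : A) : ainner A x (y <• a) = ainner A x y * a := by
  simp [ainner]

theorem star_ainner (x y : E) : star (ainner A x y) = ainner A y x := by
  simp [ainner, ← MulOpposite.unop_star]

variable [StarOrderedRing A]

/-- The `A`-valued inner product as a continuous sesquilinear map. -/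
def ainnerL : E →L⋆[ℂ] E →L[ℂ] A :=
  (ContinuousLinearMap.compL ℂ E Aᵐᵒᵖ A
    ((MulOpposite.opContinuousLinearEquiv ℂ (M := A)).symm : Aᵐᵒᵖ →L[ℂ] A)).comp
    (CStarModule.innerSL (A := Aᵐᵒᵖ) (E := E))

@[simp]
theorem ainnerL_apply (x y : E) : ainnerL A x y = ainner A x y := rfl

/-- `F` is a closed `A`-submodule of the right Hilbert `A`-module `E`. -/
structure IsClosedSubmodule (F : Submodule ℂ E) : Prop where
  isClosed : IsClosed (F : Set E)
  smul_mem : ∀ x ∈ F, ∀ a : A, x <• a ∈ F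

/-- `F` is countably generated as a Hilbert `A`-module: there is a countable subset `S` of `F`
such that the finite sums of elements `x a`, with `x` in `S` and `a` in `A`, are dense in `F`. -/
def IsCountablyGenerated (F : Submodule ℂ E) : Prop :=
  ∃ S : Set E, S.Countable ∧ S ⊆ F ∧
    F ≤ (Submodule.span ℂ {z : E | ∃ x ∈ S, ∃ a : A, z = x <• a}).topologicalClosure

/-- `F` and `G` are isomorphic as Hilbert `A`-modules: there is a bijective `A`-linear map
from `F` to `G` that preserves the `A`-valued inner product. -/
def AreIsomorphic (F G : Submodule ℂ E) : Prop :=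
  ∃ u : F ≃ₗ[ℂ] G,
    (∀ (x : F) (a : A) (hx : (x : E) <• a ∈ F), (u ⟨(x : E) <• a, hx⟩ : E) = (u x : E) <• a) ∧
    ∀ x y : F, ainner A (u x : E) (u y : E) = ainner A (x : E) (y : E)

end Inner

/-! ### Biduals -/

/-- The Banach space bidual `X''`. -/
abbrev Bidual (X : Type*) [NormedAddCommGroup X] [NormedSpace ℂ X] : Type _ :=
  StrongDual ℂ (StrongDual ℂ X)

/-- The bitranspose `T'' : X'' → Y''` of a bounded linear map `T : X → Y`,
given by `(T'' ξ) g = ξ (g ∘ T)`. -/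
def bitranspose {X Y : Type*} [NormedAddCommGroup X] [NormedSpace ℂ X]
    [NormedAddCommGroup Y] [NormedSpace ℂ Y] (T : X →L[ℂ] Y) : Bidual X →L[ℂ] Bidual Y :=
  ContinuousLinearMap.precomp ℂ (ContinuousLinearMap.precomp ℂ T)

@[simp]
theorem bitranspose_apply {X Y : Type*} [NormedAddCommGroup X] [NormedSpace ℂ X]
    [NormedAddCommGroup Y] [NormedSpace ℂ Y] (T : X →L[ℂ] Y) (ξ : Bidual X)
    (g : StrongDual ℂ Y) : bitranspose T ξ g = ξ (g.comp T) := rfl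

/-- The bidual `F''` of a subspace `F` of `E`, as a subspace of `E''`: the image of the bidual of
the Banach space `F` under the (isometric) bitranspose of the inclusion map. -/
def bidualSubmodule {E : Type*} [NormedAddCommGroup E] [NormedSpace ℂ E] (F : Submodule ℂ E) :
    Submodule ℂ (Bidual E) :=
  LinearMap.range (bitranspose F.subtypeL : Bidual F →L[ℂ] Bidual E).toLinearMap

section BidualInner

variable (A : Type*) {E : Type*} [NonUnitalCStarAlgebra A] [PartialOrder A] [StarOrderedRing A]
  [NormedAddCommGroup E] [NormedSpace ℂ E] [SMul Aᵐᵒᵖ E] [CStarModule Aᵐᵒᵖ E]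

/-- For `f` in `A'`, the bounded sesquilinear form `(y, x) ↦ f ⟨y, x⟩` on `E`. -/
def formL : StrongDual ℂ A →L[ℂ] E →L⋆[ℂ] StrongDual ℂ E :=
  ((ContinuousLinearMap.compL ℂ E A ℂ).flip.comp (ainnerL A)).flip

/-- For `ξ` in `E''` and `f` in `A'`, the bounded linear functional on `E` that sends `y` to the
complex conjugate of `⟨y, ξ⟩ f = ξ (x ↦ f ⟨y, x⟩)`; it is conjugate linear in `f`. -/
def conjFunctional (ξ : Bidual E) : StrongDual ℂ A →L⋆[ℂ] StrongDual ℂ E :=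
  (ContinuousLinearMap.compSL E ℂ ℂ (starRingEnd ℂ) (starRingEnd ℂ)
      ((starL ℂ : ℂ ≃L⋆[ℂ] ℂ) : ℂ →L⋆[ℂ] ℂ)).comp
    ((ContinuousLinearMap.compSL E (StrongDual ℂ E) ℂ (starRingEnd ℂ) (RingHom.id ℂ) ξ).comp
      (formL A))

/-- The `A''`-valued inner product `⟨η, ξ⟩` on the bidual `E''` of a right Hilbert `A`-module `E`:
the extension of the `A`-valued inner product of `E` that is weak-* continuous first in `ξ`
(for `η` in `E`), then in `η`. -/
def bidualInner (η ξ : Bidual E) : Bidual A :=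
  ((starL ℂ : ℂ ≃L⋆[ℂ] ℂ) : ℂ →L⋆[ℂ] ℂ).comp (η.comp (conjFunctional A ξ))

theorem conjFunctional_apply (ξ : Bidual E) (f : StrongDual ℂ A) (y : E) :
    conjFunctional A ξ f y = star (ξ (f.comp (ainnerL A y))) := rfl

theorem bidualInner_apply (η ξ : Bidual E) (f : StrongDual ℂ A) :
    bidualInner A η ξ f = star (η (conjFunctional A ξ f)) := rfl

/-- For `y` in `E`, the map `⟨y, ·⟩ : E'' → A''` is the bitranspose of `⟨y, ·⟩ : E → A`. -/
theorem bidualInner_coe_left (y : E) (ξ : Bidual E) :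
    bidualInner A (NormedSpace.inclusionInDoubleDual ℂ E y) ξ = bitranspose (ainnerL A y) ξ := by
  ext f
  simp [bidualInner_apply, conjFunctional_apply]

/-- On `E` itself the `A''`-valued inner product is the given `A`-valued inner product. -/
theorem bidualInner_coe_coe (y x : E) :
    bidualInner A (NormedSpace.inclusionInDoubleDual ℂ E y)
      (NormedSpace.inclusionInDoubleDual ℂ E x) =
      NormedSpace.inclusionInDoubleDual ℂ A (ainner A y x) := by
  rw [bidualInner_coe_left]
  ext f
  simp

/-- The element `ξ` of `E''` is orthogonal to the subspace `F` of `E`, with respect to the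
`A''`-valued inner product. -/
def IsOrthogonalTo (ξ : Bidual E) (F : Submodule ℂ E) : Prop :=
  ∀ y ∈ F, bidualInner A (NormedSpace.inclusionInDoubleDual ℂ E y) ξ = 0

end BidualInner

end HilbertModule

end

noncomputable section

namespace HilbertModule

open Filter Topology

section Adjointable

variable (B E : Type*) [NonUnitalCStarAlgebra B] [PartialOrder B]
  [NormedAddCommGroup E] [NormedSpace ℂ E] [SMul B E] [CStarModule B E]

/-- The algebra of adjointable operators on a Hilbert module. -/
def adjointable : Subalgebra ℂ (E →L[ℂ] E) where
  carrier := {T | ∃ S : E →L[ℂ] E, ∀ x y, inner B (T x) y = inner B x (S y)}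
  mul_mem' := by
    rintro T T' ⟨S, hS⟩ ⟨S', hS'⟩
    exact ⟨S' * S, fun x y => by simp [hS, hS']⟩
  add_mem' := by
    rintro T T' ⟨S, hS⟩ ⟨S', hS'⟩
    exact ⟨S + S', fun x y => by simp [hS, hS']⟩
  algebraMap_mem' c := ⟨algebraMap ℂ (E →L[ℂ] E) (star c), fun x y => by
    simp [Algebra.algebraMap_eq_smul_one]⟩

variable {B E}

theorem ext_inner {x y : E} (h : ∀ z, inner B z x = inner B z y) : x = y := by
  rw [← sub_eq_zero, ← CStarModule.inner_self (A := B), CStarModule.inner_sub_right, h, sub_self]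

namespace adjointable

instance : CoeFun (adjointable B E) (fun _ => E → E) := ⟨fun T => (T : E →L[ℂ] E)⟩

instance : Star (adjointable B E) where
  star T := ⟨T.2.choose, T, fun x y => by
    rw [← CStarModule.star_inner, ← T.2.choose_spec, CStarModule.star_inner]⟩

theorem inner_left (T : adjointable B E) (x y : E) :
    inner B (T x) y = inner B x (star T y) := T.2.choose_spec x y

theorem inner_right (T : adjointable B E) (x y : E) :
    inner B x (T y) = inner B (star T x) y := by
  rw [← CStarModule.star_inner, inner_left, CStarModule.star_inner]

@[ext]
theorem ext {S T : adjointable B E} (h : ∀ x, S x = T x) : S = T :=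
  Subtype.ext (ContinuousLinearMap.ext h)

theorem ext_of_inner {S T : adjointable B E} (h : ∀ x y, inner B x (S y) = inner B x (T y)) :
    S = T := ext fun y => ext_inner fun x => h x y

@[simp] theorem mul_apply (S T : adjointable B E) (x : E) : (S * T) x = S (T x) := rfl
@[simp] theorem add_apply (S T : adjointable B E) (x : E) : (S + T) x = S x + T x := rfl
@[simp] theorem sub_apply (S T : adjointable B E) (x : E) : (S - T) x = S x - T x := rfl
@[simp] theorem smul_apply (c : ℂ) (T : adjointable B E) (x : E) : (c • T) x = c • T x := rfl
@[simp] theorem one_apply (x : E) : (1 : adjointable B E) x = x := rfl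

instance : StarRing (adjointable B E) where
  star_involutive T := ext_of_inner fun x y => by rw [← inner_left, ← inner_right]
  star_mul S T := ext_of_inner fun x y => by
    rw [← inner_left, mul_apply, mul_apply, inner_left, inner_left]
  star_add S T := ext_of_inner fun x y => by
    rw [← inner_left, add_apply, add_apply, CStarModule.inner_add_left,
      CStarModule.inner_add_right, inner_left, inner_left]

instance : StarModule ℂ (adjointable B E) where
  star_smul c T := ext_of_inner fun x y => by
    rw [← inner_left, smul_apply, smul_apply, CStarModule.inner_smul_left_complex,
      CStarModule.inner_smul_right_complex, inner_left]

theorem norm_apply_le (T : adjointable B E) (x : E) : ‖T x‖ ≤ ‖T‖ * ‖x‖ :=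
  (T : E →L[ℂ] E).le_opNorm x

theorem map_op_smul (T : adjointable B E) (b : B) (x : E) : T (b • x) = b • T x :=
  ext_inner (B := B) fun z => by
    rw [inner_right, CStarModule.inner_op_smul_right, CStarModule.inner_op_smul_right, inner_right]

variable [StarOrderedRing B]

theorem norm_apply_sq_le (T : adjointable B E) (x : E) :
    ‖T x‖ ^ 2 ≤ ‖star T * T‖ * ‖x‖ ^ 2 := by
  calc ‖T x‖ ^ 2 = ‖inner B x ((star T * T) x)‖ := by
        rw [CStarModule.norm_sq_eq B, inner_left, mul_apply]
    _ ≤ ‖x‖ * ‖(star T * T) x‖ := CStarModule.norm_inner_le E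
    _ ≤ ‖x‖ * (‖star T * T‖ * ‖x‖) := by gcongr; exact norm_apply_le _ _
    _ = ‖star T * T‖ * ‖x‖ ^ 2 := by ring

instance : CStarRing (adjointable B E) where
  norm_mul_self_le T := by
    have h : ‖T‖ ≤ √‖star T * T‖ := by
      refine ContinuousLinearMap.opNorm_le_bound _ (Real.sqrt_nonneg _) fun x => ?_
      refine (sq_le_sq₀ (norm_nonneg _) (by positivity)).1 ?_
      rw [mul_pow, Real.sq_sqrt (norm_nonneg (star T * T))]
      exact norm_apply_sq_le T x
    calc ‖T‖ * ‖T‖ ≤ √‖star T * T‖ * √‖star T * T‖ :=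
          mul_le_mul h h (norm_nonneg _) (Real.sqrt_nonneg _)
      _ = ‖star T * T‖ := Real.mul_self_sqrt (norm_nonneg _)

instance [CompleteSpace E] : CompleteSpace (adjointable B E) := by
  refine Metric.complete_of_cauchySeq_tendsto fun u hu => ?_
  have hu' : CauchySeq fun n => (u n : E →L[ℂ] E) := hu.map uniformContinuous_subtype_val
  have hs : CauchySeq fun n => ((star (u n) : adjointable B E) : E →L[ℂ] E) :=
    (hu.map (starNormedAddGroupHom (E := adjointable B E)).uniformContinuous).map
      uniformContinuous_subtype_val
  obtain ⟨T, hT⟩ := cauchySeq_tendsto_of_complete hu'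
  obtain ⟨S, hS⟩ := cauchySeq_tendsto_of_complete hs
  have key : T ∈ adjointable B E := by
    refine ⟨S, fun x y => ?_⟩
    have h1 : Tendsto (fun n => inner B (u n x) y) atTop (𝓝 (inner B (T x) y)) := by
      have := ((CStarModule.continuous_inner (A := B) (E := E)).tendsto (T x, y)).comp
        ((((ContinuousLinearMap.apply ℂ E x).continuous.tendsto T).comp hT).prodMk_nhds
          tendsto_const_nhds)
      exact this
    have h2 : Tendsto (fun n => inner B x (star (u n) y)) atTop (𝓝 (inner B x (S y))) := by
      have := ((CStarModule.continuous_inner (A := B) (E := E)).tendsto (x, S y)).comp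
        ((tendsto_const_nhds (x := x)).prodMk_nhds
          (((ContinuousLinearMap.apply ℂ E y).continuous.tendsto S).comp hS))
      exact this
    simp_rw [inner_left] at h1
    exact tendsto_nhds_unique h1 h2
  exact ⟨⟨T, key⟩, tendsto_subtype_rng.2 hT⟩

instance [CompleteSpace E] : CStarAlgebra (adjointable B E) where

instance [CompleteSpace E] : PartialOrder (adjointable B E) := CStarAlgebra.spectralOrder _

instance [CompleteSpace E] : StarOrderedRing (adjointable B E) :=
  CStarAlgebra.spectralOrderedRing _

theorem inner_apply_nonneg [CompleteSpace E] {T : adjointable B E} (hT : 0 ≤ T) (x : E) :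
    0 ≤ inner B x (T x) := by
  obtain ⟨S, rfl⟩ := CStarAlgebra.nonneg_iff_eq_star_mul_self.1 hT
  rw [mul_apply, ← inner_left]
  exact CStarModule.inner_self_nonneg

theorem inner_apply_mono [CompleteSpace E] {S T : adjointable B E} (h : S ≤ T) (x : E) :
    inner B x (S x) ≤ inner B x (T x) := by
  rw [← sub_nonneg, ← CStarModule.inner_sub_right, ← sub_apply]
  exact inner_apply_nonneg (sub_nonneg.2 h) x

theorem nonneg_of_inner_apply_nonneg [CompleteSpace E] {T : adjointable B E}
    (hT : IsSelfAdjoint T) (h : ∀ x, 0 ≤ inner B x (T x)) : 0 ≤ T := by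
  obtain ⟨N, hN, hTN, hT0⟩ : ∃ N : adjointable B E, 0 ≤ N ∧ T * N = -(N * N) ∧ (N = 0 → 0 ≤ T) := by
    refine ⟨T⁻, CFC.negPart_nonneg T, ?_, (CFC.negPart_eq_zero_iff T hT).1⟩
    nth_rw 1 [← CFC.posPart_sub_negPart T hT]
    rw [sub_mul, CFC.posPart_mul_negPart, zero_sub]
  obtain ⟨R, hR⟩ := CStarAlgebra.nonneg_iff_eq_star_mul_self.1 hN
  have hNR : ∀ x, N x = star R (R x) := fun x => by rw [hR, mul_apply]
  have key : ∀ x, R (N x) = 0 := fun x => by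
    have h1 := h (N x)
    rw [← mul_apply, hTN] at h1
    have h3 : inner B (N x) (N (N x)) = 0 := by
      refine le_antisymm ?_ (inner_apply_nonneg hN (N x))
      rw [← neg_nonneg, ← CStarModule.inner_neg_right]
      exact h1
    rwa [hNR (N x), ← inner_left, CStarModule.inner_self] at h3
  refine hT0 (ext fun x => ?_)
  have h1 : N (N x) = 0 := by
    rw [hNR (N x), key x]
    exact map_zero ((star R : adjointable B E) : E →L[ℂ] E)
  have h2 : inner B (N x) (N x) = 0 := by
    rw [inner_left, (IsSelfAdjoint.of_nonneg hN).star_eq, h1, CStarModule.inner_zero_right]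
  rw [CStarModule.inner_self.1 h2]
  rfl

end adjointable
end Adjointable

section ScaledResolvent

variable {C : Type*} [CStarAlgebra C] [PartialOrder C] [StarOrderedRing C]

/-- The operator `(1 + (n + 1) h)⁻¹`, for a positive element `h` of a C*-algebra. -/
def scaledResolvent (h : C) (n : ℕ) : C := cfc (fun t : ℝ => (1 + (n + 1) * t)⁻¹) h

variable {h : C}

theorem continuousOn_scaledResolvent (hh : 0 ≤ h) (n : ℕ) :
    ContinuousOn (fun t : ℝ => (1 + (n + 1) * t)⁻¹) (spectrum ℝ h) := by
  refine ContinuousOn.inv₀ (by fun_prop) fun t ht => ?_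
  have := spectrum_nonneg_of_nonneg hh ht
  positivity

theorem scaledResolvent_nonneg (hh : 0 ≤ h) (n : ℕ) : 0 ≤ scaledResolvent h n := by
  refine cfc_nonneg fun t ht => ?_
  have := spectrum_nonneg_of_nonneg hh ht
  positivity

theorem scaledResolvent_antitone (hh : 0 ≤ h) : Antitone (scaledResolvent h) := by
  intro m n hmn
  refine cfc_mono (fun t ht => ?_) (continuousOn_scaledResolvent hh n)
    (continuousOn_scaledResolvent hh m)
  have := spectrum_nonneg_of_nonneg hh ht
  gcongr

theorem scaledResolvent_mul_self_le (hh : 0 ≤ h) (n : ℕ) :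
    scaledResolvent h n * scaledResolvent h n ≤ scaledResolvent h n := by
  have hc := continuousOn_scaledResolvent hh n
  rw [scaledResolvent, ← cfc_mul _ _ h hc hc]
  refine cfc_mono (fun t ht => ?_) (hc.mul hc) hc
  have := spectrum_nonneg_of_nonneg hh ht
  refine mul_le_of_le_one_left (by positivity) (inv_le_one_of_one_le₀ ?_)
  nlinarith [mul_nonneg (by positivity : (0:ℝ) ≤ n + 1) this]

theorem mul_scaledResolvent (hh : 0 ≤ h) (n : ℕ) :
    h * ((n + 1 : ℝ) • scaledResolvent h n) = 1 - scaledResolvent h n := by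
  have hc := continuousOn_scaledResolvent hh n
  have hsa : IsSelfAdjoint h := .of_nonneg hh
  calc h * ((n + 1 : ℝ) • scaledResolvent h n)
      = cfc (fun t : ℝ => t * ((n + 1 : ℝ) • (1 + (n + 1) * t)⁻¹)) h := by
        rw [cfc_mul (fun t : ℝ => t) (fun t : ℝ => (n + 1 : ℝ) • (1 + (n + 1) * t)⁻¹) h
          (by fun_prop) (hc.const_smul ((n : ℝ) + 1)), cfc_id' ℝ h, cfc_smul _ _ h hc, scaledResolvent]
    _ = cfc (fun t : ℝ => 1 - (1 + (n + 1) * t)⁻¹) h := by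
        refine cfc_congr fun t ht => ?_
        have := spectrum_nonneg_of_nonneg hh ht
        have : 1 + ((n : ℝ) + 1) * t ≠ 0 := by positivity
        simp only [smul_eq_mul]
        field_simp
        ring
    _ = 1 - scaledResolvent h n := by
        rw [cfc_sub _ _ h (by fun_prop) hc, cfc_const_one ℝ h, scaledResolvent]

theorem norm_scaledResolvent_mul_mul_le (hh : 0 ≤ h) (n : ℕ) :
    ‖scaledResolvent h n * h * scaledResolvent h n‖ ≤ 1 / ((n : ℝ) + 1) := by
  have hc := continuousOn_scaledResolvent hh n
  have hsa : IsSelfAdjoint h := .of_nonneg hh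
  have : scaledResolvent h n * h * scaledResolvent h n =
      cfc (fun t : ℝ => (1 + (n + 1) * t)⁻¹ * t * (1 + (n + 1) * t)⁻¹) h := by
    rw [cfc_mul (fun t : ℝ => (1 + (n + 1) * t)⁻¹ * t) _ h (hc.mul continuousOn_id) hc,
      cfc_mul _ (fun t : ℝ => t) h hc continuousOn_id, cfc_id' ℝ h, scaledResolvent]
  rw [this]
  refine norm_cfc_le (by positivity) fun t ht => ?_
  have ht0 := spectrum_nonneg_of_nonneg hh ht
  have hp : 0 < 1 + ((n : ℝ) + 1) * t := by positivity
  rw [Real.norm_of_nonneg (by positivity), inv_mul_eq_div, ← div_eq_mul_inv, div_div,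
    div_le_div_iff₀ (by positivity) (by positivity)]
  nlinarith [mul_nonneg (by positivity : (0:ℝ) ≤ n + 1) ht0]

theorem isSelfAdjoint_scaledResolvent (hh : 0 ≤ h) (n : ℕ) :
    IsSelfAdjoint (scaledResolvent h n) := .of_nonneg (scaledResolvent_nonneg hh n)

end ScaledResolvent

section Adjointable

variable {B E : Type*} [NonUnitalCStarAlgebra B] [PartialOrder B]
  [NormedAddCommGroup E] [NormedSpace ℂ E] [SMul B E] [CStarModule B E]

variable (B) in
theorem norm_op_smul_le (b : B) (x : E) : ‖b • x‖ ≤ ‖b‖ * ‖x‖ := by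
  refine (sq_le_sq₀ (norm_nonneg _) (by positivity)).1 ?_
  calc ‖b • x‖ ^ 2 = ‖b * (inner B x x * star b)‖ := by
        rw [CStarModule.norm_sq_eq B, CStarModule.inner_op_smul_right,
          CStarModule.inner_op_smul_left]
    _ ≤ ‖b‖ * (‖inner B x x‖ * ‖b‖) := by
        refine (norm_mul_le _ _).trans ?_
        gcongr
        exact (norm_mul_le _ _).trans_eq (by rw [norm_star])
    _ = (‖b‖ * ‖x‖) ^ 2 := by rw [mul_pow, CStarModule.norm_sq_eq B (x := x)]; ring

namespace adjointable

variable (B) in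
theorem op_smul_left_add (a b : B) (x : E) : (a + b) • x = a • x + b • x :=
  ext_inner (B := B) fun z => by simp [add_mul]

variable (B) in
theorem op_smul_left_smul (c : ℂ) (b : B) (x : E) : (c • b) • x = c • b • x :=
  ext_inner (B := B) fun z => by simp [smul_mul_assoc]

theorem smul_mem_closure_range (h : adjointable B E) {x : E} (b : B)
    (hx : x ∈ (LinearMap.range (h : E →L[ℂ] E).toLinearMap).topologicalClosure) :
    b • x ∈ (LinearMap.range (h : E →L[ℂ] E).toLinearMap).topologicalClosure := by
  have hcont : Continuous fun y : E => b • y := by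
    let f : E →+ E :=
      { toFun := fun y => b • y
        map_zero' := ext_inner (B := B) fun z => by simp
        map_add' := fun y z => ext_inner (B := B) fun w => by simp [mul_add] }
    exact AddMonoidHomClass.continuous_of_bound f ‖b‖ (norm_op_smul_le B b)
  refine map_mem_closure hcont hx ?_
  rintro _ ⟨z, rfl⟩
  exact ⟨b • z, map_op_smul h b z⟩

variable [StarOrderedRing B]

variable (B) in
/-- The operator `z ↦ x ⟨x, z⟩` as a bounded linear map. -/
def rankOneL (x : E) : E →L[ℂ] E :=
  LinearMap.mkContinuous
    { toFun := fun z => inner B x z • x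
      map_add' := fun z w => by rw [CStarModule.inner_add_right, op_smul_left_add]
      map_smul' := fun c z => by
        rw [CStarModule.inner_smul_right_complex, op_smul_left_smul, RingHom.id_apply] }
    (‖x‖ * ‖x‖) fun z => by
      refine (norm_op_smul_le B _ _).trans ?_
      calc ‖inner B x z‖ * ‖x‖ ≤ (‖x‖ * ‖z‖) * ‖x‖ := by
            gcongr; exact CStarModule.norm_inner_le E
        _ = ‖x‖ * ‖x‖ * ‖z‖ := by ring

theorem inner_rankOneL_left (x z w : E) :
    inner B (rankOneL B x z) w = inner B z (rankOneL B x w) := by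
  change inner B (inner B x z • x) w = inner B z (inner B x w • x)
  simp

variable (B) in
/-- The operator `z ↦ x ⟨x, z⟩` as an adjointable operator. -/
def rankOne (x : E) : adjointable B E := ⟨rankOneL B x, rankOneL B x, inner_rankOneL_left x⟩

theorem rankOne_apply (x z : E) : rankOne B x z = inner B x z • x := rfl

theorem isSelfAdjoint_rankOne (x : E) : IsSelfAdjoint (rankOne B x) :=
  ext_of_inner fun z w => by rw [← inner_left]; exact inner_rankOneL_left x z w

theorem rankOne_nonneg [CompleteSpace E] (x : E) : 0 ≤ rankOne B x :=
  nonneg_of_inner_apply_nonneg (isSelfAdjoint_rankOne x) fun z => by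
    rw [rankOne_apply, CStarModule.inner_op_smul_right, ← CStarModule.star_inner z x]
    exact star_mul_self_nonneg _

theorem norm_apply_sq_le_norm_mul_rankOne_mul {r : adjointable B E} (hr : IsSelfAdjoint r)
    (x : E) : ‖r x‖ ^ 2 ≤ ‖r * rankOne B x * r‖ := by
  rcases eq_or_ne (r x) 0 with h0 | h0
  · rw [h0, norm_zero, zero_pow two_ne_zero]; exact norm_nonneg _
  have h1 : inner B (r x) ((r * rankOne B x * r) (r x)) =
      inner B (r x) (r x) * inner B (r x) (r x) := by
    have h2 : inner B x (r (r x)) = inner B (r x) (r x) := by rw [inner_right, hr.star_eq]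
    rw [mul_apply, mul_apply, inner_right, hr.star_eq, rankOne_apply,
      CStarModule.inner_op_smul_right, h2, ← CStarModule.star_inner x (r (r x)), h2,
      CStarModule.star_inner]
  have h2 : ‖r x‖ ^ 2 * ‖r x‖ ^ 2 ≤ ‖r * rankOne B x * r‖ * ‖r x‖ ^ 2 := by
    calc ‖r x‖ ^ 2 * ‖r x‖ ^ 2 = ‖inner B (r x) ((r * rankOne B x * r) (r x))‖ := by
          rw [h1, CStarModule.norm_sq_eq B]
          nth_rw 3 [← CStarModule.star_inner]
          rw [CStarRing.norm_star_mul_self]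
      _ ≤ ‖r x‖ * (‖r * rankOne B x * r‖ * ‖r x‖) :=
          (CStarModule.norm_inner_le E).trans (by gcongr; exact norm_apply_le _ _)
      _ = ‖r * rankOne B x * r‖ * ‖r x‖ ^ 2 := by ring
  have : 0 < ‖r x‖ := norm_pos_iff.2 h0
  exact le_of_mul_le_mul_right h2 (by positivity)

theorem mem_closure_range_of_tendsto [CompleteSpace E] {h : adjointable B E} (hh : 0 ≤ h) {x : E}
    (hx : Tendsto (fun n => scaledResolvent h n x) atTop (𝓝 0)) :
    x ∈ (LinearMap.range (h : E →L[ℂ] E).toLinearMap).topologicalClosure := by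
  have : Tendsto (fun n : ℕ => h (((n + 1 : ℝ) • scaledResolvent h n) x)) atTop (𝓝 x) := by
    have h1 : Tendsto (fun n => x - scaledResolvent h n x) atTop (𝓝 (x - 0)) :=
      tendsto_const_nhds.sub hx
    rw [sub_zero] at h1
    refine h1.congr fun n => ?_
    rw [← mul_apply, mul_scaledResolvent hh, sub_apply, one_apply]
  exact mem_closure_of_tendsto this (Eventually.of_forall fun n => ⟨_, rfl⟩)

theorem mem_closure_range_of_smul_rankOne_le [CompleteSpace E] {h : adjointable B E} {x : E} {c : ℝ}
    (hc : 0 < c) (hle : c • rankOne B x ≤ h) :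
    x ∈ (LinearMap.range (h : E →L[ℂ] E).toLinearMap).topologicalClosure := by
  have hx0 : 0 ≤ c • rankOne B x := smul_nonneg hc.le (rankOne_nonneg x)
  have hh : 0 ≤ h := hx0.trans hle
  refine mem_closure_range_of_tendsto hh ?_
  have hb : ∀ n, ‖scaledResolvent h n x‖ ^ 2 ≤ c⁻¹ * (1 / ((n : ℝ) + 1)) := fun n => by
    have hr := isSelfAdjoint_scaledResolvent hh n
    have h1 := star_left_conjugate_le_conjugate hle (scaledResolvent h n)
    have h0 := star_left_conjugate_nonneg hx0 (scaledResolvent h n)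
    have h2 := (CStarAlgebra.norm_le_norm_of_nonneg_of_le h0 h1)
    rw [hr.star_eq, mul_smul_comm, smul_mul_assoc, norm_smul, Real.norm_of_nonneg hc.le] at h2
    have h3 := norm_apply_sq_le_norm_mul_rankOne_mul hr x
    have h4 := norm_scaledResolvent_mul_mul_le hh n
    rw [inv_mul_eq_div, le_div_iff₀' hc]
    calc _ ≤ c * ‖scaledResolvent h n * rankOne B x * scaledResolvent h n‖ := by gcongr
      _ ≤ _ := h2.trans h4
  have ht : Tendsto (fun n : ℕ => c⁻¹ * (1 / ((n : ℝ) + 1))) atTop (𝓝 0) := by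
    simpa using tendsto_one_div_add_atTop_nhds_zero_nat.const_mul c⁻¹
  rw [tendsto_zero_iff_norm_tendsto_zero]
  have h2 := squeeze_zero (fun n => sq_nonneg _) hb ht
  simpa [Real.sqrt_sq] using h2.sqrt

/-- A countably generated closed submodule is the closed range of a positive operator. -/
theorem exists_nonneg_closure_range [CompleteSpace E] {F : Submodule ℂ E} (hF : IsClosed (F : Set E))
    (hsmul : ∀ x ∈ F, ∀ b : B, b • x ∈ F) {S : Set E} (hS : S.Countable) (hSF : S ⊆ F)
    (hgen : F ≤ (Submodule.span ℂ {z : E | ∃ x ∈ S, ∃ b : B, z = b • x}).topologicalClosure) :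
    ∃ e : adjointable B E, 0 ≤ e ∧ (∀ z, e z ∈ F) ∧
      F ≤ (LinearMap.range (e : E →L[ℂ] E).toLinearMap).topologicalClosure := by
  obtain ⟨x, hx⟩ := (hS.insert 0).exists_eq_range (Set.insert_nonempty 0 S)
  have hxF : ∀ n, x n ∈ F := fun n => by
    have : x n ∈ insert 0 S := hx ▸ Set.mem_range_self n
    rcases this with h | h
    · rw [h]; exact F.zero_mem
    · exact hSF h
  let c : ℕ → ℝ := fun n => (1 / 2) ^ n / (1 + ‖rankOne B (x n)‖)
  have hc : ∀ n, 0 < c n := fun n => by positivity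
  have hsum : Summable fun n => c n • rankOne B (x n) := by
    refine Summable.of_norm_bounded summable_geometric_two fun n => ?_
    rw [norm_smul, Real.norm_of_nonneg (hc n).le, div_mul_eq_mul_div,
      div_le_iff₀ (by positivity)]
    gcongr
    simp
  have hnonneg : ∀ n, 0 ≤ c n • rankOne B (x n) :=
    fun n => smul_nonneg (hc n).le (rankOne_nonneg _)
  refine ⟨∑' n, c n • rankOne B (x n), tsum_nonneg hnonneg, fun z => ?_, ?_⟩
  · have h1 : HasSum (fun n => (c n • rankOne B (x n)) z) ((∑' n, c n • rankOne B (x n)) z) :=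
      hsum.hasSum.mapL ((ContinuousLinearMap.apply ℂ E z).comp
        (adjointable B E).toSubmodule.subtypeL)
    refine hF.mem_of_tendsto h1 (Eventually.of_forall fun s => F.sum_mem fun n _ => ?_)
    exact F.smul_of_tower_mem (c n) (hsmul _ (hxF n) _)
  · refine hgen.trans (Submodule.topologicalClosure_minimal _ (Submodule.span_le.2 ?_)
      (Submodule.isClosed_topologicalClosure _))
    rintro _ ⟨y, hy, b, rfl⟩
    obtain ⟨n, rfl⟩ : y ∈ Set.range x := hx ▸ Set.mem_insert_of_mem 0 hy
    exact smul_mem_closure_range _ b (mem_closure_range_of_smul_rankOne_le (hc n)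
      (hsum.le_tsum n fun m _ => hnonneg m))

end adjointable
end Adjointable

theorem tendsto_zero_of_mem_closure {X Y : Type*} [SeminormedAddCommGroup X]
    [SeminormedAddCommGroup Y] {φ : ℕ → X → Y} {M : ℝ}
    (hφ : ∀ n x y, ‖φ n x - φ n y‖ ≤ M * ‖x - y‖) {s : Set X}
    (hs : ∀ x ∈ s, Tendsto (fun n => φ n x) atTop (𝓝 0)) {x : X} (hx : x ∈ closure s) :
    Tendsto (fun n => φ n x) atTop (𝓝 0) := by
  have hM : 0 < |M| + 1 := by positivity
  rw [Metric.tendsto_atTop]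
  intro ε hε
  obtain ⟨y, hy, hxy⟩ := Metric.mem_closure_iff.1 hx (ε / 2 / (|M| + 1)) (by positivity)
  obtain ⟨N, hN⟩ := Metric.tendsto_atTop.1 (hs y hy) (ε / 2) (by positivity)
  refine ⟨N, fun n hn => ?_⟩
  have h1 := hN n hn
  rw [dist_zero_right] at h1 ⊢
  rw [dist_eq_norm, lt_div_iff₀' hM] at hxy
  have h2 : M * ‖x - y‖ ≤ (|M| + 1) * ‖x - y‖ := by
    gcongr
    linarith [le_abs_self M]
  calc ‖φ n x‖ = ‖(φ n x - φ n y) + φ n y‖ := by rw [sub_add_cancel]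
    _ ≤ ‖φ n x - φ n y‖ + ‖φ n y‖ := norm_add_le _ _
    _ < ε := by linarith [hφ n x y]

/-- Dini's theorem in a C*-algebra: a decreasing sequence of positive elements that tends to `0`
weakly tends to `0` in norm. -/
theorem tendsto_zero_of_antitone_of_weak {B : Type*} [NonUnitalCStarAlgebra B] [PartialOrder B]
    [StarOrderedRing B] {b : ℕ → B} (hb : Antitone b) (hb0 : ∀ n, 0 ≤ b n)
    (hw : ∀ f : StrongDual ℂ B, Tendsto (fun n => f (b n)) atTop (𝓝 0)) :
    Tendsto b atTop (𝓝 0) := by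
  let C : Set B := {c | ∃ n, b n ≤ c}
  have hconv : Convex ℝ C := by
    rintro c ⟨m, hm⟩ d ⟨n, hn⟩ s t hs ht hst
    refine ⟨max m n, ?_⟩
    calc b (max m n) = s • b (max m n) + t • b (max m n) := by rw [← add_smul, hst, one_smul]
      _ ≤ s • c + t • d := add_le_add
          (smul_le_smul_of_nonneg_left ((hb (le_max_left m n)).trans hm) hs)
          (smul_le_smul_of_nonneg_left ((hb (le_max_right m n)).trans hn) ht)
  have h0 : (0 : B) ∈ closure C := by
    by_contra h
    obtain ⟨f, u, hu, hf⟩ := RCLike.geometric_hahn_banach_point_closed (𝕜 := ℂ)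
      hconv.closure isClosed_closure h
    rw [map_zero, map_zero] at hu
    have h1 : Tendsto (fun n => RCLike.re (f (b n))) atTop (𝓝 (RCLike.re (0 : ℂ))) :=
      (RCLike.continuous_re.tendsto _).comp (hw f)
    rw [map_zero] at h1
    exact absurd (ge_of_tendsto' h1 fun n => (hf _ (subset_closure ⟨n, le_rfl⟩)).le) (not_le.2 hu)
  rw [Metric.tendsto_atTop]
  intro ε hε
  obtain ⟨c, ⟨N, hN⟩, hc⟩ := Metric.mem_closure_iff.1 h0 ε hε
  rw [dist_zero_left] at hc
  refine ⟨N, fun n hn => ?_⟩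
  rw [dist_zero_right]
  exact (CStarAlgebra.norm_le_norm_of_nonneg_of_le (hb0 n) ((hb hn).trans hN)).trans_lt hc

/-- A vector that is annihilated by all bounded functionals vanishing on a subspace lies in the
closure of the subspace. -/
theorem mem_topologicalClosure_of_forall_dual {X : Type*} [NormedAddCommGroup X] [NormedSpace ℂ X]
    {p : Submodule ℂ X} {x : X} (h : ∀ f : StrongDual ℂ X, (∀ y ∈ p, f y = 0) → f x = 0) :
    x ∈ p.topologicalClosure := by
  by_contra hx
  obtain ⟨f, u, hf, hu⟩ := RCLike.geometric_hahn_banach_closed_point (𝕜 := ℂ)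
    (p.topologicalClosure.restrictScalars ℝ).convex p.isClosed_topologicalClosure hx
  have h0 : 0 < u := by simpa using hf 0 (Submodule.zero_mem _)
  have key : ∀ y ∈ p, f y = 0 := fun y hy => by
    by_contra hy0
    have := hf (((u : ℂ) / f y) • y) (p.le_topologicalClosure (p.smul_mem _ hy))
    rw [map_smul, smul_eq_mul, div_mul_cancel₀ _ hy0] at this
    simp at this
  rw [h f key] at hu
  simp at hu
  exact lt_asymm h0 hu

section Adjointable

variable {B E : Type*} [NonUnitalCStarAlgebra B] [PartialOrder B] [StarOrderedRing B]
  [NormedAddCommGroup E] [NormedSpace ℂ E] [SMul B E] [CStarModule B E] [CompleteSpace E]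

namespace adjointable

/-- Let `x = e₂ e₁`, where `e₁` and `e₂` are positive operators with closed ranges `F₁` and `F₂`.
If bounded sequences in `F₁` that are asymptotically orthogonal to `F₂` tend weakly to `0`,
then `x* x` has closed range containing `F₁`. -/
theorem le_closure_range_star_mul_self {F₁ F₂ : Submodule ℂ E} {e₁ e₂ : adjointable B E}
    (he₁ : 0 ≤ e₁) (he₂ : 0 ≤ e₂) (hmem₁ : ∀ z, e₁ z ∈ F₁)
    (hF₁ : F₁ ≤ (LinearMap.range (e₁ : E →L[ℂ] E).toLinearMap).topologicalClosure)
    (hF₂ : F₂ ≤ (LinearMap.range (e₂ : E →L[ℂ] E).toLinearMap).topologicalClosure)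
    (hw : ∀ (w : ℕ → E) (M : ℝ), (∀ n, w n ∈ F₁) → (∀ n, ‖w n‖ ≤ M) →
      (∀ y ∈ F₂, Tendsto (fun n => inner B y (w n)) atTop (𝓝 0)) →
      ∀ f : StrongDual ℂ E, Tendsto (fun n => f (w n)) atTop (𝓝 0)) :
    F₁ ≤ (LinearMap.range ((star (e₂ * e₁) * (e₂ * e₁) : adjointable B E) :
      E →L[ℂ] E).toLinearMap).topologicalClosure := by
  obtain ⟨h, hh⟩ : ∃ h : adjointable B E, h = star (e₂ * e₁) * (e₂ * e₁) := ⟨_, rfl⟩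
  rw [← hh]
  have h0 : 0 ≤ h := hh ▸ star_mul_self_nonneg _
  have hs₁ := IsSelfAdjoint.of_nonneg he₁
  have hs₂ := IsSelfAdjoint.of_nonneg he₂
  let k : ℕ → adjointable B E := scaledResolvent h
  have hk0 : ∀ n, 0 ≤ k n := scaledResolvent_nonneg h0
  have hks : ∀ n, star (k n) = k n := fun n => (IsSelfAdjoint.of_nonneg (hk0 n)).star_eq
  have hkn : ∀ n, ‖k n‖ ≤ ‖k 0‖ := fun n =>
    CStarAlgebra.norm_le_norm_of_nonneg_of_le (hk0 n) (scaledResolvent_antitone h0 n.zero_le)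
  have hxk : Tendsto (fun n => ‖e₂ * e₁ * k n‖) atTop (𝓝 0) := by
    have h1 : ∀ n, ‖e₂ * e₁ * k n‖ ^ 2 ≤ 1 / ((n : ℝ) + 1) := fun n => by
      rw [sq, ← CStarRing.norm_star_mul_self (x := e₂ * e₁ * k n), star_mul (e₂ * e₁), hks]
      calc _ = ‖k n * h * k n‖ := by rw [hh]; simp only [mul_assoc]
        _ ≤ _ := norm_scaledResolvent_mul_mul_le h0 n
    have h2 := squeeze_zero (fun n => sq_nonneg _) h1 tendsto_one_div_add_atTop_nhds_zero_nat
    simpa [Real.sqrt_sq] using h2.sqrt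
  have hweak : ∀ (z : E) (f : StrongDual ℂ E),
      Tendsto (fun n => f (e₁ (k n z))) atTop (𝓝 0) := fun z => by
    have hb : ∀ n, ‖e₁ (k n z)‖ ≤ ‖e₁‖ * (‖k 0‖ * ‖z‖) := fun n => by
      refine (norm_apply_le _ _).trans ?_
      gcongr
      refine (norm_apply_le _ _).trans ?_
      gcongr
      exact hkn n
    refine hw _ _ (fun n => hmem₁ _) hb fun y hy => ?_
    refine tendsto_zero_of_mem_closure (φ := fun n y => inner B y (e₁ (k n z)))
      (M := ‖e₁‖ * (‖k 0‖ * ‖z‖)) (fun n v w => ?_) ?_ (hF₂ hy)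
    · rw [← CStarModule.inner_sub_left, mul_comm]
      refine (CStarModule.norm_inner_le E).trans ?_
      gcongr
      exact hb n
    · rintro _ ⟨t, rfl⟩
      refine squeeze_zero_norm (a := fun n => ‖t‖ * (‖e₂ * e₁ * k n‖ * ‖z‖)) (fun n => ?_) ?_
      · change ‖inner B (e₂ t) (e₁ (k n z))‖ ≤ _
        rw [inner_left, hs₂.star_eq]
        refine (CStarModule.norm_inner_le E).trans ?_
        gcongr
        exact norm_apply_le (e₂ * e₁ * k n) z
      · simpa using (hxk.mul_const ‖z‖).const_mul ‖t‖
  refine hF₁.trans (Submodule.topologicalClosure_minimal _ ?_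
    (Submodule.isClosed_topologicalClosure _))
  rintro _ ⟨a, rfl⟩
  change e₁ a ∈ _
  refine mem_closure_range_of_tendsto h0 ?_
  have hdini : Tendsto (fun n => inner B (e₁ a) (k n (e₁ a))) atTop (𝓝 0) := by
    refine tendsto_zero_of_antitone_of_weak
      (fun m n hmn => inner_apply_mono (scaledResolvent_antitone h0 hmn) _)
      (fun n => inner_apply_nonneg (hk0 n) _) fun g => ?_
    refine (hweak (e₁ a) (g.comp (CStarModule.innerSL a))).congr fun n => ?_
    change g (inner B a (e₁ (k n (e₁ a)))) = _
    rw [inner_right, hs₁.star_eq]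
  have h1 : ∀ n, ‖k n (e₁ a)‖ ^ 2 ≤ ‖inner B (e₁ a) (k n (e₁ a))‖ := fun n => by
    rw [CStarModule.norm_sq_eq B, inner_left, hks, ← mul_apply]
    refine CStarAlgebra.norm_le_norm_of_nonneg_of_le (inner_apply_nonneg ?_ _)
      (inner_apply_mono (scaledResolvent_mul_self_le h0 n) _)
    simpa only [hks] using star_mul_self_nonneg (k n)
  rw [tendsto_zero_iff_norm_tendsto_zero]
  have h2 := squeeze_zero (fun n => sq_nonneg _) h1 (tendsto_zero_iff_norm_tendsto_zero.1 hdini)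
  simpa [Real.sqrt_sq] using h2.sqrt

/-- The isometric part of the polar decomposition of `x`, on a subspace of the closed range
of `x* x`. -/
theorem exists_inner_preserving (x : adjointable B E) {F : Submodule ℂ E}
    (hF : F ≤ (LinearMap.range ((star x * x : adjointable B E) :
      E →L[ℂ] E).toLinearMap).topologicalClosure) :
    ∃ u : F →ₗ[ℂ] E, (∀ a b : F, inner B (u a) (u b) = inner B (a : E) (b : E)) ∧
      ∀ a, u a ∈ (LinearMap.range (x : E →L[ℂ] E).toLinearMap).topologicalClosure := by
  obtain ⟨s, hs, hsx⟩ : ∃ s : adjointable B E, IsSelfAdjoint s ∧ s * s = star x * x :=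
    ⟨CFC.sqrt (star x * x), .of_nonneg (CFC.sqrt_nonneg _),
      CFC.sqrt_mul_sqrt_self _ (star_mul_self_nonneg x)⟩
  have hinner : ∀ z w, inner B (x z) (x w) = inner B (s z) (s w) := fun z w => by
    rw [inner_left x, inner_left s, hs.star_eq, ← mul_apply, ← mul_apply, hsx]
  let K : Submodule ℂ E := (LinearMap.range (s : E →L[ℂ] E).toLinearMap).topologicalClosure
  have hFK : F ≤ K := hF.trans (Submodule.topologicalClosure_mono (by
    rintro _ ⟨z, rfl⟩
    refine ⟨s z, ?_⟩
    change s (s z) = (star x * x : adjointable B E) z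
    rw [← hsx, mul_apply]))
  let e : E →ₗ[ℂ] K := (s : E →L[ℂ] E).toLinearMap.codRestrict K fun z =>
    Submodule.le_topologicalClosure _ ⟨z, rfl⟩
  have hdense : DenseRange e := by
    intro ⟨y, hy⟩
    rw [closure_subtype]
    refine closure_mono ?_ hy
    rintro _ ⟨z, rfl⟩
    exact ⟨e z, ⟨z, rfl⟩, rfl⟩
  have hnorm : ∀ z, ‖(x : E →L[ℂ] E).toLinearMap z‖ ≤ 1 * ‖e z‖ := fun z => by
    rw [one_mul]
    change ‖x z‖ ≤ ‖s z‖
    rw [CStarModule.norm_eq_sqrt_norm_inner_self (A := B) (x z), hinner,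
      ← CStarModule.norm_eq_sqrt_norm_inner_self]
  let v : K →L[ℂ] E := (x : E →L[ℂ] E).toLinearMap.extendOfNorm e
  have hv : ∀ z, v (e z) = x z := LinearMap.extendOfNorm_eq hdense ⟨1, hnorm⟩
  have hinner' : ∀ a b : K, inner B (v a) (v b) = inner B (a : E) (b : E) := by
    have hcont : Continuous fun p : K × K => inner B (v p.1) (v p.2) :=
      (CStarModule.continuous_inner (A := B) (E := E)).comp (by fun_prop : Continuous
        fun p : K × K => (v p.1, v p.2))
    have hcont' : Continuous fun p : K × K => inner B (p.1 : E) (p.2 : E) :=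
      (CStarModule.continuous_inner (A := B) (E := E)).comp (by fun_prop : Continuous
        fun p : K × K => ((p.1 : E), (p.2 : E)))
    refine hdense.induction_on₂ (isClosed_eq hcont hcont') fun z w => ?_
    rw [hv, hv, hinner]
    rfl
  refine ⟨v.toLinearMap ∘ₗ Submodule.inclusion hFK, fun a b => hinner' _ _, fun a => ?_⟩
  refine hdense.induction_on (Submodule.inclusion hFK a)
    (p := fun y => v y ∈ (LinearMap.range (x : E →L[ℂ] E).toLinearMap).topologicalClosure)
    ((Submodule.isClosed_topologicalClosure _).preimage v.continuous) fun z => ?_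
  rw [hv]
  exact Submodule.le_topologicalClosure _ ⟨z, rfl⟩

end adjointable
end Adjointable

section RightModule

variable {A E : Type*} [NonUnitalCStarAlgebra A] [PartialOrder A]
  [NormedAddCommGroup E] [NormedSpace ℂ E] [SMul Aᵐᵒᵖ E] [CStarModule Aᵐᵒᵖ E]

/-- A linear map that preserves the inner product is linear over the C*-algebra. -/
theorem map_op_smul_of_inner_preserving {B : Type*} [NonUnitalCStarAlgebra B] [PartialOrder B]
    [SMul B E] [CStarModule B E] {F : Submodule ℂ E} {u : F →ₗ[ℂ] E}
    (hu : ∀ a b : F, inner B (u a) (u b) = inner B (a : E) (b : E)) (x : F) (b : B)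
    (hx : b • (x : E) ∈ F) : u ⟨b • (x : E), hx⟩ = b • u x := by
  rw [← sub_eq_zero, ← CStarModule.inner_self (A := B)]
  simp [hu, mul_assoc]

theorem areIsomorphic_range {F : Submodule ℂ E} {u : F →ₗ[ℂ] E}
    (hu : ∀ a b : F, inner Aᵐᵒᵖ (u a) (u b) = inner Aᵐᵒᵖ (a : E) (b : E))
    (hinj : Function.Injective u) : AreIsomorphic A F (LinearMap.range u) :=
  ⟨LinearEquiv.ofInjective u hinj,
    fun x a hx => map_op_smul_of_inner_preserving hu x (MulOpposite.op a) hx,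
    fun x y => congrArg MulOpposite.unop (hu x y)⟩

theorem isClosedSubmodule_range [CompleteSpace E] {F : Submodule ℂ E}
    (hF : IsClosedSubmodule A F) {u : F →ₗ[ℂ] E}
    (hu : ∀ a b : F, inner Aᵐᵒᵖ (u a) (u b) = inner Aᵐᵒᵖ (a : E) (b : E)) (hiso : Isometry u) :
    IsClosedSubmodule A (LinearMap.range u) where
  isClosed := by
    have := hF.isClosed.completeSpace_coe
    rw [LinearMap.coe_range]
    exact hiso.isClosedEmbedding.isClosed_range
  smul_mem := by
    rintro _ ⟨x, rfl⟩ a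
    exact ⟨⟨(x : E) <• a, hF.smul_mem x x.2 a⟩,
      map_op_smul_of_inner_preserving hu x (MulOpposite.op a) _⟩

variable [StarOrderedRing A]

theorem comp_subtypeL_mem_closure {F₁ F₂ : Submodule ℂ E}
    (horth : ∀ ξ ∈ bidualSubmodule F₁, IsOrthogonalTo A ξ F₂ → ξ = 0) (f : StrongDual ℂ E) :
    f.comp F₁.subtypeL ∈ (Submodule.span ℂ {d : StrongDual ℂ F₁ | ∃ y ∈ F₂, ∃ g : StrongDual ℂ A,
      d = (g.comp (ainnerL A y)).comp F₁.subtypeL}).topologicalClosure := by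
  refine mem_topologicalClosure_of_forall_dual (X := StrongDual ℂ F₁) fun ξ hξ => ?_
  have h0 : bitranspose F₁.subtypeL ξ = 0 := horth _ ⟨ξ, rfl⟩ fun y hy => by
    rw [bidualInner_coe_left]
    ext g
    exact hξ _ (Submodule.subset_span ⟨y, hy, g, rfl⟩)
  exact DFunLike.congr_fun h0 f

/-- If no non-zero element of `F₁''` is orthogonal to `F₂`, then bounded sequences in `F₁` that are
asymptotically orthogonal to `F₂` tend weakly to `0`. -/
theorem tendsto_dual_zero_of_asymptotically_orthogonal {F₁ F₂ : Submodule ℂ E}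
    (horth : ∀ ξ ∈ bidualSubmodule F₁, IsOrthogonalTo A ξ F₂ → ξ = 0) {w : ℕ → E} {M : ℝ}
    (hw : ∀ n, w n ∈ F₁) (hM : ∀ n, ‖w n‖ ≤ M)
    (hlim : ∀ y ∈ F₂, Tendsto (fun n => ainner A y (w n)) atTop (𝓝 0)) (f : StrongDual ℂ E) :
    Tendsto (fun n => f (w n)) atTop (𝓝 0) := by
  refine tendsto_zero_of_mem_closure (φ := fun n (d : StrongDual ℂ F₁) => d ⟨w n, hw n⟩) (M := M)
    (fun n d d' => ?_) (fun d hd => ?_) (comp_subtypeL_mem_closure horth f)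
  · rw [← sub_apply, mul_comm]
    exact (ContinuousLinearMap.le_opNorm _ _).trans (by gcongr; exact hM n)
  · induction hd using Submodule.span_induction with
    | mem d hd =>
      obtain ⟨y, hy, g, rfl⟩ := hd
      have := (g.continuous.tendsto 0).comp (hlim y hy)
      rwa [map_zero] at this
    | zero => exact tendsto_const_nhds
    | add d d' _ _ h h' => simpa using h.add h'
    | smul c d _ h => simpa using h.const_mul c

end RightModule

end HilbertModule

end

theorem theorem7p1 {A E : Type*} [NonUnitalCStarAlgebra A] [PartialOrder A] [StarOrderedRing A]
    [NormedAddCommGroup E] [NormedSpace ℂ E] [CompleteSpace E]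
    [SMul Aᵐᵒᵖ E] [CStarModule Aᵐᵒᵖ E]
    (E₁ E₂ : Submodule ℂ E)
    (hE₁ : HilbertModule.IsClosedSubmodule A E₁) (hE₂ : HilbertModule.IsClosedSubmodule A E₂)
    (hcg₁ : HilbertModule.IsCountablyGenerated A E₁)
    (hcg₂ : HilbertModule.IsCountablyGenerated A E₂)
    (horth : ∀ ξ ∈ HilbertModule.bidualSubmodule E₁,
      HilbertModule.IsOrthogonalTo A ξ E₂ → ξ = 0) :
    ∃ G : Submodule ℂ E, HilbertModule.IsClosedSubmodule A G ∧ G ≤ E₂ ∧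
      HilbertModule.AreIsomorphic A E₁ G := by
  have strict : ∀ F : Submodule ℂ E, HilbertModule.IsClosedSubmodule A F →
      HilbertModule.IsCountablyGenerated A F →
      ∃ e : HilbertModule.adjointable Aᵐᵒᵖ E, 0 ≤ e ∧ (∀ z, e z ∈ F) ∧
        F ≤ (LinearMap.range (e : E →L[ℂ] E).toLinearMap).topologicalClosure := by
    rintro F hF ⟨S, hS, hSF, hgen⟩
    refine HilbertModule.adjointable.exists_nonneg_closure_range hF.isClosed
      (fun x hx b => hF.smul_mem x hx b.unop) hS hSF (hgen.trans ?_)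
    refine Submodule.topologicalClosure_mono (Submodule.span_mono ?_)
    rintro _ ⟨x, hx, a, rfl⟩
    exact ⟨x, hx, MulOpposite.op a, rfl⟩
  obtain ⟨e₁, he₁, hmem₁, hcl₁⟩ := strict E₁ hE₁ hcg₁
  obtain ⟨e₂, he₂, hmem₂, hcl₂⟩ := strict E₂ hE₂ hcg₂
  have hdense := HilbertModule.adjointable.le_closure_range_star_mul_self he₁ he₂ hmem₁ hcl₁ hcl₂
    fun w M hw hM hlim f =>
      HilbertModule.tendsto_dual_zero_of_asymptotically_orthogonal (A := A) horth hw hM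
        (fun y hy => (MulOpposite.continuous_unop.tendsto 0).comp (hlim y hy)) f
  obtain ⟨u, hu, hux⟩ := HilbertModule.adjointable.exists_inner_preserving (e₂ * e₁) hdense
  have hiso : Isometry u := AddMonoidHomClass.isometry_of_norm u fun x => by
    rw [CStarModule.norm_eq_sqrt_norm_inner_self (A := Aᵐᵒᵖ) (u x), hu,
      ← CStarModule.norm_eq_sqrt_norm_inner_self, Submodule.coe_norm]
  refine ⟨LinearMap.range u, HilbertModule.isClosedSubmodule_range hE₁ hu hiso, ?_,
    HilbertModule.areIsomorphic_range hu hiso.injective⟩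
  rintro _ ⟨x, rfl⟩
  refine Submodule.topologicalClosure_minimal _ ?_ hE₂.isClosed (hux x)
  rintro _ ⟨z, rfl⟩
  exact hmem₂ _
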